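/- **Setting.** Let $\mathcal T_h$ be a finite tetrahedral triangulation (conforming) of a polyhedral domain $\Omega\subset\mathbb R^3$, with set of facets $\mathcal E_h=\mathcal E_h^0\cup\mathcal E_h^\partial$ (interior and boundary facets), $h_e$ the diameter of the facet $e$, and $n$ the outer unit normal. On an interior facet, $\llbracket f\rrbracket=f_1n_1+f_2n_2$ and $\{f\}=\frac12(f_1+f_2)$; on a boundary facet, $\llbracket f\rrbracket=fn$ and $\{f\}=f$. Let $\langle\cdot,\cdot\rangle$ be the $L^2(\Omega)$ inner product; gradients of discontinuous functions are taken elementwise. Fix integers $r,k\ge 0$ and put $$U_h^{\rm grad}=\{u\in H^1_0(\Omega)^3: u|_K\in P_{r+1}(K)^3\},\qquad F_h=\{f\in L^2(\Omega): f|_K\in P_k(K)\},$$ $$U_h^{\rm div}=\{B\in H_0({\rm div},\Omega): B|_K\in P_r(K)^3+xP_r(K)\},\qquad U_h^{\rm curl}=\{v\in H_0({\rm curl},\Omega): v|_K\in P_r(K)^3+x\times P_r(K)^3\}$$ (for all $K\in\mathcal T_h$): continuous Galerkin, discontinuous Galerkin, Raviart–Thomas and Nédélec elements. Let $\mu_0>0$,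 $\mu\ge0$, $\lambda+\frac23\mu\ge0$, $\kappa\ge0$, $\nu\ge0$, $\eta>0$ be constants, $R:\overline\Omega\to\mathbb R^3$ and $\phi:\overline\Omega\to\mathbb R$ continuous, $\varepsilon(\rho,s)$ an internal energy density that is $C^1$ on an open set of states, $\sigma(u)=\mu(\nabla u+\nabla u^{\mathsf T})+\lambda({\rm div}\,u)I$, and $$\ell(u,\rho,s,B)=\int_\Omega\Big[\tfrac12\rho|u|^2+\rho R\cdot u-\varepsilon(\rho,s)-\tfrac1{2\mu_0}|B|^2-\rho\phi\Big]dx ,$$ so that $\frac{\delta\ell}{\delta u}=\rho(u+R)$, $\frac{\delta\ell}{\delta\rho}=\frac12|u|^2+R\cdot u-\partial_\rho\varepsilon-\phi$, $\frac{\delta\ell}{\delta s}=-\partial_s\varepsilon$, $\frac{\delta\ell}{\delta B}=-\frac1{\mu_0}B$. The total energy is $\mathcal E=\langle\frac{\delta\ell}{\delta u},u\rangle-\ell(u,\rho,s,B)=\int_\Omega[\frac12\rho|u|^2+\varepsilon(\rho,s)+\frac1{2\mu_0}|B|^2+\rho\phi]\,dx$. **Operators.** Put $a(w,u,v)=-\int_\Omega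 w\cdot[u,v]\,dx$ with $[u,v]=u\cdot\nabla v-v\cdot\nabla u$, $c(w,u,v)=\int_\Omega w\,\sigma(u):\nabla v\,dx$, $$b_h^1(f,g,u)=-\sum_{K}\int_K(u\cdot\nabla f)g\,dx+\sum_{e\in\mathcal E_h}\int_eu\cdot\llbracket f\rrbracket\{g\}\,da,$$ $$d_h^N(w,f,g)=-\sum_K\int_K\frac wf\kappa\nabla f\cdot\nabla g\,dx+\sum_{e\in\mathcal E_h^0}\int_e\Big(\frac{\{w\kappa\nabla f\}\cdot\llbracket g\rrbracket-\{w\kappa\nabla g\}\cdot\llbracket f\rrbracket}{\{f\}}-\frac\eta{h_e}\frac{\{w\}}{\{f\}}\llbracket f\rrbracket\cdot\llbracket g\rrbracket\Big)da .$$ According to the thermal boundary condition, with given integrable $q_0,T_0:\partial\Omega\to\mathbb R$: * homogeneous Neumann: $d_h=d_h^N$, $e_h(w,f)=0$; * nonhomogeneous Neumann (heat flux $q_0$): $d_h(w,f,g)=d_h^N(w,f,g)+\int_{\partial\Omega}\frac wf\kappa\,(\nabla f\cdot n)\,g\,da$, $e_h(w,f)=\int_{\partial\Omega}wq_0\,da$;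 * Dirichlet ($T=T_0$): $d_h(w,f,g)=d_h^N(w,f,g)-\int_{\partial\Omega}\frac wf\kappa(\nabla g\cdot n)(f-T_0)\,da+\int_{\partial\Omega}\frac wf\kappa(\nabla f\cdot n)g\,da$, $e_h(w,f)=-\int_{\partial\Omega}\frac wf\kappa(\nabla f\cdot n)T_0\,da+\sum_{e\in\mathcal E_h^\partial}\frac\eta{h_e}\int_ew(f-T_0)\,da$. For a thermoelectric coefficient $\alpha$ (elementwise $C^1$ up to the boundary of each element, possibly depending on time and on the solution; $\alpha=0$ without thermoelectric effect) let $$h_h(w,g,D)=-\int_{\partial\Omega}D\cdot(w\alpha\,n\times\nabla g)\,da+\sum_K\int_KD\cdot(\nabla(w\alpha)\times\nabla g)\,dx-\sum_{e\in\mathcal E_h^0}\int_e\{D\}\cdot\big(\llbracket w\alpha\rrbracket\times\{\nabla g\}+\{\nabla(w\alpha)\}\times\llbracket g\rrbracket\big)da .$$ **Scheme.** On a nondegenerate time interval $I$, let $u\in U_h^{\rm grad}$, $B\in U_h^{\rm div}$, $\rho,s\in F_h$ be differentiable in time, with $(\rho,s)$ in the open set of states where $\varepsilon$ is given, on every closed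 element, and let $\theta,T\in F_h$, with $T>0$ on every closed element, and $J,H,U,E,L\in U_h^{\rm curl}$, be such that for all $t\in I$ $$\langle\partial_t(\rho(u+R)),v\rangle+a(\rho(u+R),u,v)+b_h^1(\theta,\rho,v)-b_h^1(T,s,v)+\langle L,v\rangle=-c(1,u,v)\quad\forall v\in U_h^{\rm grad},$$ $$\langle\partial_tB,C\rangle+\langle{\rm curl}E,C\rangle=-\nu\langle{\rm curl}J,C\rangle-h_h(1,T,C)\quad\forall C\in U_h^{\rm div},\qquad \langle\partial_t\rho,\sigma\rangle+b_h^1(\sigma,\rho,u)=0\quad\forall\sigma\in F_h,$$ $$\langle\partial_ts,Tw\rangle+b_h^1(Tw,s,u)-d_h(1,T,Tw)-h_h(1,Tw,\tfrac1{\mu_0}B)=c(w,u,u)+\nu\langle wJ,J\rangle-d_h(w,T,T)-e_h(w,T)\quad\forall w\in F_h,$$ where $\theta$ and $T$ are the $L^2$ projections of $\frac{\delta\ell}{\delta\rho}$ and $-\frac{\delta\ell}{\delta s}$ onto $F_h$ and, for all $K\in U_h^{\rm curl}$, $\langle J,K\rangle=\frac1{\mu_0}\langle B,{\rm curl}K\rangle$,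 $\langle H,K\rangle=\langle B,K\rangle$, $\langle U,K\rangle=\langle u,K\rangle$, $\langle E,K\rangle=-\langle U\times H,K\rangle$, $\langle L,K\rangle=-\langle J\times H,K\rangle$. (Also admitted is the variant of the scheme in which $\rho(u+R)$ in the first argument of $a$, and $Tw$ in $b_h^1$, $d_h$ and $h_h$, are replaced by their $L^2$ projections onto $U_h^{\rm grad}$ and $F_h$.) **Claim.** The total energy is differentiable on $I$ and $$\frac{d\mathcal E}{dt}=-e_h(1,T).$$ In particular: 1. for homogeneous Neumann conditions, $\mathcal E$ is constant on $I$; 2. for nonhomogeneous Neumann conditions, $\frac{d\mathcal E}{dt}=-\int_{\partial\Omega}q_0\,da$, exactly as for the continuous system; 3. for Dirichlet conditions, with $j_s=-\frac\kappa T\nabla T$, $$\frac{d\mathcal E}{dt}=-\int_{\partial\Omega}T_0\,(j_s\cdot n)\,da-\sum_{e\in\mathcal E_h^\partial}\frac\eta{h_e}\int_e(T-T_0)\,da ,$$ which is the discrete counterpart of the balance $\frac{d\mathcal E}{dt}=-\int_{\partial\Omega}T_0(j_s\cdot n)\,da$ (the additional term is the penalty by which the Dirichlet condition is imposed) and coincides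 with it at every time at which $T=T_0$ on $\partial\Omega$. -/

import Mathlib

open MeasureTheory
open scoped ContDiff Gradient

noncomputable section

namespace MHD

/-! ### Euclidean three-space, vector calculus -/

/-- Euclidean three-space. -/
abbrev E3 : Type := EuclideanSpace ℝ (Fin 3)

/-- The cross product. -/
def cross (a b : E3) : E3 :=
  !₂[a 1 * b 2 - a 2 * b 1, a 2 * b 0 - a 0 * b 2, a 0 * b 1 - a 1 * b 0]

/-- The partial derivative `∂ⱼ vᵢ` at `x`. -/
def pd (v : E3 → E3) (x : E3) (i j : Fin 3) : ℝ :=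
  (fderiv ℝ v x (EuclideanSpace.single j 1)) i

/-- The curl of a (differentiable) vector field. -/
def curl (v : E3 → E3) (x : E3) : E3 :=
  !₂[pd v x 2 1 - pd v x 1 2, pd v x 0 2 - pd v x 2 0, pd v x 1 0 - pd v x 0 1]

/-! ### Sobolev spaces with vanishing traces

On an open set `Ω` the weak derivatives below are tested against all smooth compactly supported
functions on the whole space (not only those supported in `Ω`). This says at once that the weak
derivative exists in `L²(Ω)` and that the corresponding trace on `∂Ω` vanishes. -/

/-- `f ∈ H¹₀(Ω)`. -/
def MemH10 (Ω : Set E3) (f : E3 → ℝ) : Prop :=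
  MemLp f 2 (volume.restrict Ω) ∧
  ∃ g : E3 → E3, MemLp g 2 (volume.restrict Ω) ∧
    ∀ ψ : E3 → ℝ, ContDiff ℝ ∞ ψ → HasCompactSupport ψ →
      ∫ x in Ω, f x • ∇ ψ x = - ∫ x in Ω, ψ x • g x

/-- `u ∈ H₀(div, Ω)`: the weak divergence is in `L²` and `u · n = 0` on `∂Ω`. -/
def MemH0div (Ω : Set E3) (u : E3 → E3) : Prop :=
  MemLp u 2 (volume.restrict Ω) ∧
  ∃ d : E3 → ℝ, MemLp d 2 (volume.restrict Ω) ∧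
    ∀ ψ : E3 → ℝ, ContDiff ℝ ∞ ψ → HasCompactSupport ψ →
      ∫ x in Ω, inner ℝ (u x) (∇ ψ x) = - ∫ x in Ω, d x * ψ x

/-- `u ∈ H₀(curl, Ω)`: the weak curl is in `L²` and `u × n = 0` on `∂Ω`. -/
def MemH0curl (Ω : Set E3) (u : E3 → E3) : Prop :=
  MemLp u 2 (volume.restrict Ω) ∧
  ∃ c : E3 → E3, MemLp c 2 (volume.restrict Ω) ∧
    ∀ ψ : E3 → E3, ContDiff ℝ ∞ ψ → HasCompactSupport ψ →
      ∫ x in Ω, inner ℝ (u x) (curl ψ x) = ∫ x in Ω, inner ℝ (c x) (ψ x)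

/-! ### Triangulations -/

/-- A tetrahedral triangulation: a finite geometric simplicial complex in three-space, all of
whose simplices are faces of tetrahedra. -/
structure TetMesh where
  complex : Geometry.SimplicialComplex ℝ E3
  finite : complex.faces.Finite
  pure : ∀ s ∈ complex.faces, ∃ K ∈ complex.faces, s ⊆ K ∧ K.card = 4

namespace TetMesh

/-- The tetrahedra `K ∈ 𝒯ₕ`, each given by its set of four vertices. -/
def Tet (M : TetMesh) : Type := {K : Finset E3 // K ∈ M.complex.faces ∧ K.card = 4}

instance (M : TetMesh) : Finite M.Tet :=
  (M.finite.subset (fun _ h => h.1) :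
    Set.Finite {K : Finset E3 | K ∈ M.complex.faces ∧ K.card = 4})

instance (M : TetMesh) : Fintype M.Tet := Fintype.ofFinite _

/-- The closed tetrahedron. -/
def cell {M : TetMesh} (K : M.Tet) : Set E3 := convexHull ℝ (K.1 : Set E3)

/-- The closed polyhedron covered by the mesh. -/
def closedDomain (M : TetMesh) : Set E3 := M.complex.space

/-- The polyhedral domain `Ω`. -/
def domain (M : TetMesh) : Set E3 := interior M.closedDomain

/-- The set `ℰₕ` of triangular facets, each given by its set of three vertices. -/
def facets (M : TetMesh) : Finset (Finset E3) :=
  (M.finite.subset (fun _ h => h.1) :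
    Set.Finite {e : Finset E3 | e ∈ M.complex.faces ∧ e.card = 3}).toFinset

open Classical in
/-- The tetrahedra that have `e` as a face. -/
def adj (M : TetMesh) (e : Finset E3) : Finset M.Tet := Finset.univ.filter (fun K => e ⊆ K.1)

/-- The interior facets, shared by two tetrahedra. -/
def intFacets (M : TetMesh) : Finset (Finset E3) := M.facets.filter (fun e => (M.adj e).card = 2)

/-- The boundary facets, belonging to one tetrahedron only. -/
def bdryFacets (M : TetMesh) : Finset (Finset E3) := M.facets.filter (fun e => (M.adj e).card = 1)

open Classical in
/-- The unit normal to the facet `e` of `K` that points out of `K`: the direction, orthogonal to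
the plane of `e`, that leads from the vertex of `K` opposite to `e` (the only element of `K \ e`)
to that plane. -/
def normal {M : TetMesh} (K : M.Tet) (e : Finset E3) : E3 :=
  ∑ a ∈ K.1 \ e,
    let v := (vectorSpan ℝ (e : Set E3))ᗮ.starProjection (e.centroid ℝ id - a)
    ‖v‖⁻¹ • v

/-- The integral `∫ₑ f da` over the triangle `e`, for the two-dimensional area measure. -/
def facetInt (e : Finset E3) (f : E3 → ℝ) : ℝ :=
  ∫ x in convexHull ℝ (e : Set E3), f x ∂(Measure.euclideanHausdorffMeasure 2)

/-- The size `hₑ` of a facet. -/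
def facetSize (e : Finset E3) : ℝ := Metric.diam (convexHull ℝ (e : Set E3))

/-- Integrability on `∂Ω` of given boundary data. -/
def BdryIntegrable (M : TetMesh) (f : E3 → ℝ) : Prop :=
  ∀ e ∈ M.bdryFacets,
    IntegrableOn f (convexHull ℝ (e : Set E3)) (Measure.euclideanHausdorffMeasure 2)

/-- Piecewise (broken) fields: one function for each tetrahedron. The value at a point of a facet
of `K` of the function belonging to `K` is the trace from `K`. In the finite element spaces the
function belonging to `K` is a polynomial, regarded as a function on the whole space. -/
abbrev Field (M : TetMesh) (V : Type) : Type := M.Tet → E3 → V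

open Classical in
/-- The almost everywhere defined function on `Ω` that a broken field represents. -/
def glue {M : TetMesh} {V : Type} [AddCommMonoid V] (f : M.Field V) (x : E3) : V :=
  ∑ K : M.Tet, if x ∈ interior (cell K) then f K x else 0

/-- `∫_∂Ω F da`, where `F` may depend on the adjacent tetrahedron `K` and the outer normal `n`. -/
def bdryInt (M : TetMesh) (F : M.Tet → E3 → E3 → ℝ) : ℝ :=
  ∑ e ∈ M.bdryFacets, ∑ K ∈ M.adj e, facetInt e (fun x => F K (normal K e) x)

/-- `∫_Ω f dx = ∑_K ∫_K f dx`. -/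
def cellInt {M : TetMesh} (f : M.Field ℝ) : ℝ := ∑ K : M.Tet, ∫ x in cell K, f K x

/-- The `L²(Ω)` inner product of scalar or vector broken fields. -/
def ip {M : TetMesh} {V : Type} [NormedAddCommGroup V] [InnerProductSpace ℝ V]
    (f g : M.Field V) : ℝ :=
  cellInt (fun K x => inner ℝ (f K x) (g K x))

/-- The jump `⟦f⟧ = f₁ n₁ + f₂ n₂` (on a boundary facet: `f n`). -/
def jump {M : TetMesh} (f : M.Field ℝ) (e : Finset E3) (x : E3) : E3 :=
  ∑ K ∈ M.adj e, f K x • normal K e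

/-- The average `{f} = (f₁ + f₂) / 2` (on a boundary facet: `f`). -/
def avg {M : TetMesh} {V : Type} [AddCommGroup V] [Module ℝ V]
    (f : M.Field V) (e : Finset E3) (x : E3) : V :=
  ((M.adj e).card : ℝ)⁻¹ • ∑ K ∈ M.adj e, f K x

/-- The elementwise gradient. -/
def grad {M : TetMesh} (f : M.Field ℝ) : M.Field E3 := fun K x => ∇ (f K) x

/-- The elementwise curl; on piecewise polynomial members of `H₀(curl, Ω)` it is the weak curl. -/
def bcurl {M : TetMesh} (v : M.Field E3) : M.Field E3 := fun K x => curl (v K) x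

/-- The pointwise cross product. -/
def bcross {M : TetMesh} (v w : M.Field E3) : M.Field E3 := fun K x => cross (v K x) (w K x)

end TetMesh

open TetMesh

/-! ### Finite element spaces -/

/-- `f ∈ P_r`: polynomial of degree at most `r`. -/
def IsPoly (r : ℕ) (f : E3 → ℝ) : Prop :=
  ∃ p : MvPolynomial (Fin 3) ℝ, p.totalDegree ≤ r ∧ ∀ x, f x = MvPolynomial.eval (fun i => x i) p

/-- `v ∈ P_r³`. -/
def IsPolyVec (r : ℕ) (v : E3 → E3) : Prop := ∀ i, IsPoly r (fun x => v x i)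

/-- The discontinuous Galerkin space `DG_s`. -/
def DG (M : TetMesh) (s : ℕ) : Set (M.Field ℝ) := {f | ∀ K, IsPoly s (f K)}

/-- The continuous Galerkin space `CG_r³` with zero boundary values. -/
def CG (M : TetMesh) (r : ℕ) : Set (M.Field E3) :=
  {u | (∀ K, IsPolyVec r (u K)) ∧ ∀ i, MemH10 M.domain (fun x => glue u x i)}

/-- The Raviart–Thomas space `RT_r` with vanishing normal trace. -/
def RT (M : TetMesh) (r : ℕ) : Set (M.Field E3) :=
  {B | (∀ K, ∃ (a : E3 → E3) (q : E3 → ℝ), IsPolyVec r a ∧ IsPoly r q ∧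
      ∀ x, B K x = a x + q x • x) ∧ MemH0div M.domain (glue B)}

/-- The Nédélec space of the first kind `NED_r` with vanishing tangential trace. -/
def NED (M : TetMesh) (r : ℕ) : Set (M.Field E3) :=
  {v | (∀ K, ∃ a b : E3 → E3, IsPolyVec r a ∧ IsPolyVec r b ∧
      ∀ x, v K x = a x + cross x (b x)) ∧ MemH0curl M.domain (glue v)}

/-- `p` is the `L²(Ω)`-orthogonal projection of `f` onto the finite element space `S`. -/
def IsProj {M : TetMesh} {V : Type} [NormedAddCommGroup V] [InnerProductSpace ℝ V]
    (S : Set (M.Field V)) (f p : M.Field V) : Prop :=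
  p ∈ S ∧ ∀ q ∈ S, ip p q = ip f q

/-! ### Physical data -/

/-- Coefficients, forcing and equation of state. -/
structure PhysData (M : TetMesh) where
  /-- magnetic permeability -/
  μ₀ : ℝ
  /-- shear viscosity -/
  μ : ℝ
  /-- second viscosity coefficient -/
  lam : ℝ
  /-- thermal conductivity -/
  κ : ℝ
  /-- resistivity -/
  ν : ℝ
  /-- penalty parameter of the interior penalty discretization -/
  η : ℝ
  μ₀_pos : 0 < μ₀
  μ_nonneg : 0 ≤ μ
  bulk_nonneg : 0 ≤ lam + 2 / 3 * μ
  κ_nonneg : 0 ≤ κ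
  ν_nonneg : 0 ≤ ν
  η_pos : 0 < η
  /-- vector potential of the rotation (Coriolis force) -/
  R : E3 → E3
  R_cont : ContinuousOn R M.closedDomain
  /-- gravitational potential -/
  φ : E3 → ℝ
  φ_cont : ContinuousOn φ M.closedDomain
  /-- internal energy density `ε(ρ, s)` -/
  ε : ℝ → ℝ → ℝ
  /-- the open set of states `(ρ, s)` in which the equation of state is given -/
  states : Set (ℝ × ℝ)
  states_open : IsOpen states
  ε_contDiff : ContDiffOn ℝ 1 (fun p : ℝ × ℝ => ε p.1 p.2) states

/-- The thermal boundary condition: homogeneous Neumann, nonhomogeneous Neumann `j_q · n = q₀`, or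
Dirichlet `T = T₀`. -/
inductive ThermalBC (M : TetMesh) where
  | homNeumann
  | neumann (q₀ : E3 → ℝ) (hq : M.BdryIntegrable q₀)
  | dirichlet (T₀ : E3 → ℝ) (hT : M.BdryIntegrable T₀)

namespace PhysData

variable {M : TetMesh}

/-- The Lagrangian `ℓ(u, ρ, s, B)`. -/
def lagrangian (P : PhysData M) (u : M.Field E3) (ρ s : M.Field ℝ) (B : M.Field E3) : ℝ :=
  cellInt (fun K x =>
    1 / 2 * ρ K x * ‖u K x‖ ^ 2 + ρ K x * inner ℝ (P.R x) (u K x) - P.ε (ρ K x) (s K x)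
      - 1 / (2 * P.μ₀) * ‖B K x‖ ^ 2 - ρ K x * P.φ x)

/-- The functional derivative `δℓ/δu = ρ (u + R)`. -/
def dl_du (P : PhysData M) (u : M.Field E3) (ρ : M.Field ℝ) : M.Field E3 :=
  fun K x => ρ K x • (u K x + P.R x)

/-- The functional derivative `δℓ/δρ = |u|²/2 + R · u - ∂ε/∂ρ - φ`. -/
def dl_drho (P : PhysData M) (u : M.Field E3) (ρ s : M.Field ℝ) : M.Field ℝ :=
  fun K x => 1 / 2 * ‖u K x‖ ^ 2 + inner ℝ (P.R x) (u K x)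
    - deriv (fun r => P.ε r (s K x)) (ρ K x) - P.φ x

/-- The functional derivative `δℓ/δs = - ∂ε/∂s`. -/
def dl_ds (P : PhysData M) (ρ s : M.Field ℝ) : M.Field ℝ :=
  fun K x => - deriv (fun r => P.ε (ρ K x) r) (s K x)

/-- The functional derivative `δℓ/δB = - B / μ₀`. -/
def dl_dB (P : PhysData M) (B : M.Field E3) : M.Field E3 :=
  fun K x => - (P.μ₀⁻¹ • B K x)

/-- The total energy `⟨δℓ/δu, u⟩ - ℓ(u, ρ, s, B)`. -/
def energy (P : PhysData M) (u : M.Field E3) (ρ s : M.Field ℝ) (B : M.Field E3) : ℝ :=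
  ip (P.dl_du u ρ) u - P.lagrangian u ρ s B

/-- The viscous stress `σ(u) = 2 μ Def u + λ (div u) δ`. -/
def stress (P : PhysData M) (u : E3 → E3) (x : E3) (i j : Fin 3) : ℝ :=
  2 * P.μ * ((pd u x i j + pd u x j i) / 2) + if i = j then P.lam * ∑ k, pd u x k k else 0

end PhysData

/-! ### Discrete operators -/

section Operators

variable {M : TetMesh}

/-- `a(w, u, v) = - ∫_Ω w · [u, v] dx`, with `[u, v] = u · ∇v - v · ∇u`. -/
def aForm (w u v : M.Field E3) : ℝ :=
  - cellInt (fun K x => inner ℝ (w K x) (VectorField.lieBracket ℝ (u K) (v K) x))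

/-- `b¹ₕ(f, g, u)`; on facets the continuous field `u` coincides with its average. -/
def b1 (f g : M.Field ℝ) (u : M.Field E3) : ℝ :=
  - cellInt (fun K x => inner ℝ (u K x) (grad f K x) * g K x)
    + ∑ e ∈ M.facets, facetInt e (fun x => inner ℝ (avg u e x) (jump f e x) * avg g e x)

/-- `c(w, u, v) = ∫_Ω w σ(u) : ∇v dx`. -/
def cForm (P : PhysData M) (w : M.Field ℝ) (u v : M.Field E3) : ℝ :=
  cellInt (fun K x => w K x * ∑ i, ∑ j, P.stress (u K) x i j * pd (v K) x i j)

/-- `dₕ` for homogeneous Neumann conditions: nonsymmetric interior penalty method. -/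
def dN (P : PhysData M) (w f g : M.Field ℝ) : ℝ :=
  - cellInt (fun K x => w K x / f K x * P.κ * inner ℝ (grad f K x) (grad g K x))
  + ∑ e ∈ M.intFacets, facetInt e (fun x =>
      1 / avg f e x * inner ℝ (avg (fun K y => (w K y * P.κ) • grad f K y) e x) (jump g e x))
  - ∑ e ∈ M.intFacets, facetInt e (fun x =>
      1 / avg f e x * inner ℝ (avg (fun K y => (w K y * P.κ) • grad g K y) e x) (jump f e x))
  - ∑ e ∈ M.intFacets, P.η / facetSize e * facetInt e (fun x =>
      avg w e x / avg f e x * inner ℝ (jump f e x) (jump g e x))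

/-- The heat conduction operator `dₕ(w, f, g)` for the given thermal boundary condition. -/
def dForm (P : PhysData M) : ThermalBC M → M.Field ℝ → M.Field ℝ → M.Field ℝ → ℝ
  | .homNeumann, w, f, g => dN P w f g
  | .neumann _ _, w, f, g =>
      dN P w f g
        + M.bdryInt (fun K n x => w K x / f K x * P.κ * inner ℝ (grad f K x) n * g K x)
  | .dirichlet T₀ _, w, f, g =>
      dN P w f g
        - M.bdryInt (fun K n x => w K x / f K x * P.κ * inner ℝ (grad g K x) n * (f K x - T₀ x))
        + M.bdryInt (fun K n x => w K x / f K x * P.κ * inner ℝ (grad f K x) n * g K x)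

/-- The entropy flux by heat conduction, `j_s(T) = - (κ / T) ∇T`. -/
def entropyFlux (P : PhysData M) (T : M.Field ℝ) : M.Field E3 :=
  fun K x => - ((P.κ / T K x) • grad T K x)

/-- The boundary penalty `∑ₑ (η / hₑ) ∫ₑ w (f - T₀) da` over the boundary facets. -/
def bdryPenalty (P : PhysData M) (T₀ : E3 → ℝ) (w f : M.Field ℝ) : ℝ :=
  ∑ e ∈ M.bdryFacets, P.η / facetSize e *
    ∑ K ∈ M.adj e, facetInt e (fun x => w K x * (f K x - T₀ x))

/-- The boundary operator `eₕ(w, f)` for the given thermal boundary condition. -/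
def eForm (P : PhysData M) : ThermalBC M → M.Field ℝ → M.Field ℝ → ℝ
  | .homNeumann, _, _ => 0
  | .neumann q₀ _, w, _ => M.bdryInt (fun K _ x => w K x * q₀ x)
  | .dirichlet T₀ _, w, f =>
      - M.bdryInt (fun K n x => w K x / f K x * P.κ * inner ℝ (grad f K x) n * T₀ x)
        + bdryPenalty P T₀ w f

/-- The Seebeck–Peltier operator `hₕ(w, g, D)` with thermoelectric coefficient `α`. -/
def hForm (α : M.Field ℝ) (w g : M.Field ℝ) (D : M.Field E3) : ℝ :=
  - M.bdryInt (fun K n x =>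
      inner ℝ (D K x) ((w K x * α K x) • cross n (grad g K x)))
  + cellInt (fun K x => inner ℝ (D K x) (cross (grad (w * α) K x) (grad g K x)))
  - ∑ e ∈ M.intFacets, facetInt e (fun x =>
      inner ℝ (avg D e x) (cross (jump (w * α) e x) (avg (grad g) e x)))
  - ∑ e ∈ M.intFacets, facetInt e (fun x =>
      inner ℝ (avg D e x) (cross (avg (grad (w * α)) e x) (jump g e x)))

end Operators

/-! ### The semi-discrete scheme -/

/-- Whether the (removable) outer projections of `δℓ/δu` in the momentum advection, and of the
product `T w` in the entropy equation, are present in the scheme. -/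
inductive Variant where
  | projected
  | unprojected

/-- `p` is `f`, or its projection onto `S`, according to the variant of the scheme. -/
def Variant.Represents (var : Variant) {M : TetMesh} {V : Type} [NormedAddCommGroup V]
    [InnerProductSpace ℝ V] (S : Set (M.Field V)) (f p : M.Field V) : Prop :=
  match var with
  | .projected => IsProj S f p
  | .unprojected => p = f

/-- The pointwise time derivative, on the time interval `I`, of a time dependent broken field. -/
def dt {M : TetMesh} {V : Type} [NormedAddCommGroup V] [NormedSpace ℝ V] (I : Set ℝ)
    (f : ℝ → M.Field V) (t : ℝ) : M.Field V :=
  fun K x => derivWithin (fun τ => f τ K x) I t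

/-- The unknowns of the scheme: `u, B, ρ, s` and the auxiliary variables `θ, T, J, H, U, E` and
`L` (the discrete Lorentz force term). -/
structure Unknowns (M : TetMesh) where
  u : ℝ → M.Field E3
  B : ℝ → M.Field E3
  ρ : ℝ → M.Field ℝ
  s : ℝ → M.Field ℝ
  θ : ℝ → M.Field ℝ
  T : ℝ → M.Field ℝ
  J : ℝ → M.Field E3
  H : ℝ → M.Field E3
  U : ℝ → M.Field E3
  E : ℝ → M.Field E3
  L : ℝ → M.Field E3

/-- `X` solves the semi-discrete scheme on the time interval `I`, with finite elements `CG_{r+1}³`,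
`RT_r`, `DG_k`, `DG_k`, `NED_r`, thermal boundary condition `bc` and thermoelectric coefficient `α`
(which may depend on time and space, in particular through `X`; without thermoelectric effect
`α = 0`). -/
structure IsSolution {M : TetMesh} (P : PhysData M) (bc : ThermalBC M) (var : Variant) (r k : ℕ)
    (I : Set ℝ) (α : ℝ → M.Field ℝ) (X : Unknowns M) : Prop where
  /- the unknowns lie in their finite element spaces -/
  u_mem : ∀ t ∈ I, X.u t ∈ CG M (r + 1)
  B_mem : ∀ t ∈ I, X.B t ∈ RT M r
  ρ_mem : ∀ t ∈ I, X.ρ t ∈ DG M k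
  s_mem : ∀ t ∈ I, X.s t ∈ DG M k
  J_mem : ∀ t ∈ I, X.J t ∈ NED M r
  H_mem : ∀ t ∈ I, X.H t ∈ NED M r
  U_mem : ∀ t ∈ I, X.U t ∈ NED M r
  E_mem : ∀ t ∈ I, X.E t ∈ NED M r
  L_mem : ∀ t ∈ I, X.L t ∈ NED M r
  /- differentiability in time -/
  u_diff : ∀ K x, DifferentiableOn ℝ (fun t => X.u t K x) I
  B_diff : ∀ K x, DifferentiableOn ℝ (fun t => X.B t K x) I
  ρ_diff : ∀ K x, DifferentiableOn ℝ (fun t => X.ρ t K x) I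
  s_diff : ∀ K x, DifferentiableOn ℝ (fun t => X.s t K x) I
  /- the states are admissible for the equation of state and the temperature is positive -/
  states_mem : ∀ t ∈ I, ∀ K, ∀ x ∈ cell K, (X.ρ t K x, X.s t K x) ∈ P.states
  T_pos : ∀ t ∈ I, ∀ K, ∀ x ∈ cell K, 0 < X.T t K x
  /- momentum equation -/
  momentum : ∀ t ∈ I, ∃ m, var.Represents (CG M (r + 1)) (P.dl_du (X.u t) (X.ρ t)) m ∧
    ∀ v ∈ CG M (r + 1),
      ip (dt I (fun τ => P.dl_du (X.u τ) (X.ρ τ)) t) v + aForm m (X.u t) v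
        + b1 (X.θ t) (X.ρ t) v - b1 (X.T t) (X.s t) v + ip (X.L t) v
      = - cForm P 1 (X.u t) v
  /- induction equation -/
  induction : ∀ t ∈ I, ∀ C ∈ RT M r,
      ip (dt I X.B t) C + ip (bcurl (X.E t)) C
      = - P.ν * ip (bcurl (X.J t)) C - hForm (α t) 1 (X.T t) C
  /- mass equation -/
  mass : ∀ t ∈ I, ∀ σ ∈ DG M k, ip (dt I X.ρ t) σ + b1 σ (X.ρ t) (X.u t) = 0
  /- entropy equation -/
  entropy : ∀ t ∈ I, ∀ w ∈ DG M k, ∀ y, var.Represents (DG M k) (X.T t * w) y →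
      ip (dt I X.s t) (X.T t * w) + b1 y (X.s t) (X.u t)
        - dForm P bc 1 (X.T t) y - hForm (α t) 1 y (- P.dl_dB (X.B t))
      = cForm P w (X.u t) (X.u t)
        + P.ν * cellInt (fun K x => w K x * ‖X.J t K x‖ ^ 2)
        - dForm P bc w (X.T t) (X.T t) - eForm P bc w (X.T t)
  /- auxiliary variables -/
  θ_eq : ∀ t ∈ I, IsProj (DG M k) (P.dl_drho (X.u t) (X.ρ t) (X.s t)) (X.θ t)
  T_eq : ∀ t ∈ I, IsProj (DG M k) (- P.dl_ds (X.ρ t) (X.s t)) (X.T t)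
  J_eq : ∀ t ∈ I, ∀ F ∈ NED M r, ip (X.J t) F = 1 / P.μ₀ * ip (X.B t) (bcurl F)
  H_eq : ∀ t ∈ I, ∀ F ∈ NED M r, ip (X.H t) F = ip (X.B t) F
  U_eq : ∀ t ∈ I, ∀ F ∈ NED M r, ip (X.U t) F = ip (X.u t) F
  E_eq : ∀ t ∈ I, ∀ F ∈ NED M r, ip (X.E t) F = - ip (bcross (X.U t) (X.H t)) F
  L_eq : ∀ t ∈ I, ∀ F ∈ NED M r, ip (X.L t) F = - ip (bcross (X.J t) (X.H t)) F
  /- the thermoelectric coefficient is continuously differentiable on each closed tetrahedron -/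
  α_smooth : ∀ t ∈ I, ∀ K, ∀ x ∈ cell K, ContDiffAt ℝ 1 (α t K) x

/-- The total energy at time `t`. -/
def Unknowns.energy {M : TetMesh} (X : Unknowns M) (P : PhysData M) (t : ℝ) : ℝ :=
  P.energy (X.u t) (X.ρ t) (X.s t) (X.B t)

end MHD

end

/-!
The scheme is built so that the energy balance follows from its equations by testing. Let
`δℓ/δu, δℓ/δρ, δℓ/δs, δℓ/δB` be the functional derivatives of the Lagrangian. By the chain rule
(`IsSolution.hasDerivWithinAt_energy_chain`)
`dℰ/dt = ⟨∂ₜ(δℓ/δu), u⟩ - ⟨δℓ/δρ, ∂ₜρ⟩ - ⟨δℓ/δs, ∂ₜs⟩ - ⟨δℓ/δB, ∂ₜB⟩`.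
Since `∂ₜρ` and `∂ₜs` lie again in the discontinuous Galerkin space, `δℓ/δρ` and `-δℓ/δs` may be
replaced by their projections `θ` and `T`. The terms are then given by the momentum equation tested
with `u`, the mass equation with `θ`, the entropy equation with `w = 1` and the induction equation
with `B` (`IsSolution.power_balance`). Advection cancels because `[u, u] = 0` and because both forms
`b¹ₕ` occur twice with opposite signs; heat conduction cancels between the two sides of the entropy
equation, viscous heating against the momentum equation and the thermoelectric term against the
induction equation; Ohmic heating cancels by the definition of `J`. What is left of the
electromagnetic work is `⟨U × H, J⟩ + ⟨J × H, U⟩ = 0`. Only `-eₕ(1, T)` survives.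
No integration by parts and no continuity across facets is needed.

The analytic point is the differentiation under the integral sign, as the unknowns are only assumed
to be differentiable in time at every point, without any continuity of the time derivative. They are
however curves in finite-dimensional spaces of polynomials, on which the topologies of pointwise and
of uniform convergence on a tetrahedron agree. Hence their difference quotients are bounded
uniformly on each tetrahedron (`hasBoundedSlopesOn_of_finiteDimensional`), the energy density is
`C¹`, and dominated convergence applies (`hasDerivWithinAt_setIntegral_comp`).
-/

open Filter Topology

/-! ### Finite-dimensional spaces of functions -/

section FiniteDimensionalFunctions

variable {X V : Type*} [NormedAddCommGroup V]

/-- The difference quotients at the time `t` of the time-dependent function `f` are bounded for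
times in `I` near `t`, uniformly on `S`. -/
def HasBoundedSlopesOn (f : ℝ → X → V) (S : Set X) (I : Set ℝ) (t : ℝ) : Prop :=
  ∃ C, ∀ᶠ τ in 𝓝[I \ {t}] t, ∀ x ∈ S, ‖f τ x - f t x‖ ≤ C * |τ - t|

theorem hasBoundedSlopesOn_const (g : X → V) (S : Set X) (I : Set ℝ) (t : ℝ) :
    HasBoundedSlopesOn (fun _ => g) S I t :=
  ⟨0, by simp⟩

theorem HasBoundedSlopesOn.prodMk {V' : Type*} [NormedAddCommGroup V'] {f : ℝ → X → V}
    {g : ℝ → X → V'} {S : Set X} {I : Set ℝ} {t : ℝ} (hf : HasBoundedSlopesOn f S I t)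
    (hg : HasBoundedSlopesOn g S I t) :
    HasBoundedSlopesOn (fun τ x => (f τ x, g τ x)) S I t := by
  obtain ⟨C₁, h₁⟩ := hf
  obtain ⟨C₂, h₂⟩ := hg
  refine ⟨max C₁ C₂, ?_⟩
  filter_upwards [h₁, h₂] with τ h₁ h₂ x hx
  refine max_le ((h₁ x hx).trans ?_) ((h₂ x hx).trans ?_)
  · gcongr; exact le_max_left _ _
  · gcongr; exact le_max_right _ _

variable [NormedSpace ℝ V]

theorem tendsto_slope_pi {f : ℝ → X → V} {f' : X → V} {I : Set ℝ} {t : ℝ}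
    (hd : ∀ x, HasDerivWithinAt (fun τ => f τ x) (f' x) I t) :
    Tendsto (fun τ => slope f t τ) (𝓝[I \ {t}] t) (𝓝 f') :=
  tendsto_pi_nhds.2 fun x =>
    (hasDerivWithinAt_iff_tendsto_slope.1 (hd x)).congr fun τ => by simp [slope_def_module]

/-- A finite-dimensional space of functions is closed under pointwise limits, hence contains the
pointwise time derivative of a curve in it. -/
theorem hasDerivWithinAt_mem_finiteDimensional (W : Submodule ℝ (X → V)) [FiniteDimensional ℝ W]
    {f : ℝ → X → V} {f' : X → V} {I : Set ℝ} {t : ℝ} (ht : t ∈ I)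
    (hI : UniqueDiffWithinAt ℝ I t) (hf : ∀ τ ∈ I, f τ ∈ W)
    (hd : ∀ x, HasDerivWithinAt (fun τ => f τ x) (f' x) I t) : f' ∈ W := by
  have : (𝓝[I \ {t}] t).NeBot := by
    rwa [uniqueDiffWithinAt_iff_accPt, accPt_principal_iff_nhdsWithin] at hI
  refine W.closed_of_finiteDimensional.mem_of_tendsto (tendsto_slope_pi hd) ?_
  filter_upwards [self_mem_nhdsWithin] with τ hτ
  exact W.smul_mem _ (W.sub_mem (hf τ hτ.1) (hf t ht))

/-- A curve in a finite-dimensional space of continuous functions that is differentiable at every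
point has difference quotients that are bounded uniformly on compact sets: restriction to the
compact set is automatically continuous from the topology of pointwise convergence to that of
uniform convergence. -/
theorem hasBoundedSlopesOn_of_finiteDimensional [TopologicalSpace X]
    (W : Submodule ℝ (X → V)) [FiniteDimensional ℝ W] (hW : ∀ w ∈ W, Continuous w)
    {S : Set X} (hS : IsCompact S) {f : ℝ → X → V} {f' : X → V} {I : Set ℝ} {t : ℝ} (ht : t ∈ I)
    (hI : UniqueDiffWithinAt ℝ I t) (hf : ∀ τ ∈ I, f τ ∈ W)
    (hd : ∀ x, HasDerivWithinAt (fun τ => f τ x) (f' x) I t) :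
    HasBoundedSlopesOn f S I t := by
  have hf' := hasDerivWithinAt_mem_finiteDimensional W ht hI hf hd
  have : CompactSpace S := isCompact_iff_compactSpace.1 hS
  let L : W →ₗ[ℝ] C(S, V) :=
    { toFun := fun w => ⟨fun x => w.1 x, (hW _ w.2).comp continuous_subtype_val⟩
      map_add' := fun _ _ => rfl
      map_smul' := fun _ _ => rfl }
  have hL : Continuous L := L.continuous_of_finiteDimensional
  have hopen : IsOpen {w : W | ‖L w‖ < ‖L ⟨f', hf'⟩‖ + 1} :=
    isOpen_lt (continuous_norm.comp hL) continuous_const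
  obtain ⟨U, hU, hUeq⟩ := isOpen_induced_iff.1 hopen
  have hmem : f' ∈ U := by
    have : (⟨f', hf'⟩ : W) ∈ Subtype.val ⁻¹' U := by
      rw [hUeq]; exact lt_add_one ‖L ⟨f', hf'⟩‖
    exact this
  refine ⟨‖L ⟨f', hf'⟩‖ + 1, ?_⟩
  filter_upwards [(tendsto_slope_pi hd).eventually (hU.mem_nhds hmem), self_mem_nhdsWithin]
    with τ hτU hτ x hx
  have hsl : slope f t τ ∈ W := W.smul_mem _ (W.sub_mem (hf τ hτ.1) (hf t ht))
  have hlt : ‖L ⟨slope f t τ, hsl⟩‖ < ‖L ⟨f', hf'⟩‖ + 1 := by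
    have : (⟨slope f t τ, hsl⟩ : W) ∈ Subtype.val ⁻¹' U := hτU
    rw [hUeq] at this; exact this
  have hx' : ‖slope f t τ x‖ ≤ ‖L ⟨f', hf'⟩‖ + 1 :=
    ((L ⟨slope f t τ, hsl⟩).norm_coe_le_norm ⟨x, hx⟩).trans hlt.le
  have hne : τ - t ≠ 0 := sub_ne_zero.2 hτ.2
  have : f τ x - f t x = (τ - t) • slope f t τ x := by
    simp [slope_def_module, smul_smul, hne]
  rw [this, norm_smul, Real.norm_eq_abs, mul_comm]
  gcongr

end FiniteDimensionalFunctions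

/-! ### Differentiation under the integral sign -/

/-- A `C¹` function on an open set is Lipschitz, with a uniform constant, between the points of a
compact set and all points near them. -/
theorem IsCompact.exists_norm_sub_le_of_contDiffOn {Z F : Type*} [NormedAddCommGroup Z]
    [NormedSpace ℝ Z] [FiniteDimensional ℝ Z] [NormedAddCommGroup F] [NormedSpace ℝ F]
    {O Q : Set Z} (hO : IsOpen O) {G : Z → F} (hG : ContDiffOn ℝ 1 G O) (hQ : IsCompact Q)
    (hQO : Q ⊆ O) :
    ∃ δ > 0, ∃ C, ∀ p ∈ Q, ∀ q, ‖q - p‖ < δ → ‖G q - G p‖ ≤ C * ‖q - p‖ := by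
  have : ProperSpace Z := FiniteDimensional.proper ℝ Z
  obtain ⟨δ, hδ, hsub⟩ := hQ.exists_cthickening_subset_open hO hQO
  have hcont : ContinuousOn (fderiv ℝ G) (Metric.cthickening δ Q) :=
    (hG.continuousOn_fderiv_of_isOpen hO le_rfl).mono hsub
  obtain ⟨C, hC⟩ := hQ.cthickening.exists_bound_of_continuousOn hcont
  refine ⟨δ, hδ, C, fun p hp q hq => ?_⟩
  have hball : Metric.ball p δ ⊆ Metric.cthickening δ Q :=
    (Metric.ball_subset_thickening hp δ).trans (Metric.thickening_subset_cthickening δ Q)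
  refine (convex_ball p δ).norm_image_sub_le_of_norm_fderiv_le (𝕜 := ℝ)
    (fun x hx => ?_) (fun x hx => hC x (hball hx)) (Metric.mem_ball_self hδ)
    (mem_ball_iff_norm.2 hq)
  exact (hG.contDiffAt (hO.mem_nhds (hsub (hball hx)))).differentiableAt one_ne_zero

/-- Differentiation of `∫ G(z(t, x)) dx` over a compact set for a `C¹` density `G`, where the curve
`z` is only assumed to have bounded difference quotients at the given time. -/
theorem hasDerivWithinAt_setIntegral_comp {X Z : Type*} [TopologicalSpace X] [T2Space X]
    [MeasurableSpace X] [BorelSpace X] {m : Measure X} [IsFiniteMeasureOnCompacts m]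
    [NormedAddCommGroup Z] [NormedSpace ℝ Z] [FiniteDimensional ℝ Z]
    {O : Set Z} (hO : IsOpen O) {G : Z → ℝ} (hG : ContDiffOn ℝ 1 G O)
    {S : Set X} (hS : IsCompact S) {I : Set ℝ} {t : ℝ} (ht : t ∈ I) {z : ℝ → X → Z}
    (hz : ∀ τ ∈ I, ContinuousOn (z τ) S) (hzO : ∀ τ ∈ I, Set.MapsTo (z τ) S O)
    (hbd : HasBoundedSlopesOn z S I t)
    {g : X → ℝ} (hg : ∀ x ∈ S, HasDerivWithinAt (fun τ => G (z τ x)) (g x) I t) :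
    HasDerivWithinAt (fun τ => ∫ x in S, G (z τ x) ∂m) (∫ x in S, g x ∂m) I t := by
  obtain ⟨δ, hδ, C₁, hC₁⟩ := IsCompact.exists_norm_sub_le_of_contDiffOn hO hG
    (hS.image_of_continuousOn (hz t ht)) (hzO t ht).image_subset
  obtain ⟨C₂, hC₂⟩ := hbd
  have hGc : ∀ τ ∈ I, ContinuousOn (fun x => G (z τ x)) S := fun τ hτ =>
    hG.continuousOn.comp (hz τ hτ) (hzO τ hτ)
  have hGi : ∀ τ ∈ I, IntegrableOn (fun x => G (z τ x)) S m := fun τ hτ =>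
    (hGc τ hτ).integrableOn_compact hS
  have hSm := hS.measurableSet
  rw [hasDerivWithinAt_iff_tendsto_slope]
  have hlim : Tendsto (fun τ => ∫ x in S, slope (fun σ => G (z σ x)) t τ ∂m) (𝓝[I \ {t}] t)
      (𝓝 (∫ x in S, g x ∂m)) := by
    have hsmall : ∀ᶠ τ in 𝓝[I \ {t}] t, C₂ * |τ - t| < δ := by
      have : Tendsto (fun τ => C₂ * |τ - t|) (𝓝[I \ {t}] t) (𝓝 (C₂ * |t - t|)) :=
        (Continuous.tendsto (by fun_prop) t).mono_left nhdsWithin_le_nhds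
      exact this.eventually (gt_mem_nhds (by simpa using hδ))
    refine tendsto_integral_filter_of_dominated_convergence (fun _ => |C₁| * C₂) ?_ ?_ ?_ ?_
    · filter_upwards [self_mem_nhdsWithin] with τ hτ
      simp only [slope_def_module]
      exact (((hGi τ hτ.1).sub (hGi t ht)).smul (τ - t)⁻¹).aestronglyMeasurable
    · filter_upwards [hC₂, hsmall, self_mem_nhdsWithin] with τ h2 hsm hτ
      refine (ae_restrict_iff' hSm).2 (Eventually.of_forall fun x hx => ?_)
      have hne : 0 < |τ - t| := abs_pos.2 (sub_ne_zero.2 hτ.2)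
      have h1 := hC₁ (z t x) ⟨x, hx, rfl⟩ (z τ x) ((h2 x hx).trans_lt hsm)
      rw [slope_def_module, norm_smul, norm_inv, Real.norm_eq_abs (τ - t), inv_mul_le_iff₀ hne]
      calc ‖G (z τ x) - G (z t x)‖ ≤ C₁ * ‖z τ x - z t x‖ := h1
        _ ≤ |C₁| * (C₂ * |τ - t|) := by
            gcongr
            · exact le_abs_self _
            · exact h2 x hx
        _ = |τ - t| * (|C₁| * C₂) := by ring
    · exact (integrable_const_iff.2 (Or.inr (by
        rw [isFiniteMeasure_restrict]; exact hS.measure_lt_top.ne)))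
    · refine (ae_restrict_iff' hSm).2 (Eventually.of_forall fun x hx => ?_)
      exact hasDerivWithinAt_iff_tendsto_slope.1 (hg x hx)
  refine hlim.congr' ?_
  filter_upwards [self_mem_nhdsWithin] with τ hτ
  simp only [slope_def_module]
  rw [integral_smul, integral_sub (hGi τ hτ.1) (hGi t ht)]

noncomputable section

namespace MHD

open TetMesh

/-! ### Polynomial spaces -/

/-- The scalar polynomial functions of degree at most `r`, as a linear space. -/
def polySpace (r : ℕ) : Submodule ℝ (E3 → ℝ) :=
  (MvPolynomial.restrictTotalDegree (Fin 3) ℝ r).map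
    ({ toFun := fun p x => MvPolynomial.eval (fun i => x i) p
       map_add' := fun _ _ => by ext; simp
       map_smul' := fun _ _ => by ext; simp [MvPolynomial.smul_eval] } :
      MvPolynomial (Fin 3) ℝ →ₗ[ℝ] E3 → ℝ)

theorem mem_polySpace {r : ℕ} {f : E3 → ℝ} : f ∈ polySpace r ↔ IsPoly r f := by
  simp only [polySpace, Submodule.mem_map, MvPolynomial.mem_restrictTotalDegree, IsPoly]
  exact exists_congr fun p => and_congr_right fun _ => ⟨fun h x => (congrFun h x).symm,
    fun h => funext fun x => (h x).symm⟩

instance (r : ℕ) : FiniteDimensional ℝ (polySpace r) := by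
  unfold polySpace; infer_instance

/-- The vector-valued polynomial functions of degree at most `r`, as a linear space. -/
def polyVecSpace (r : ℕ) : Submodule ℝ (E3 → E3) :=
  LinearMap.range
    ({ toFun := fun p x => WithLp.toLp 2 fun i => (p i).1 x
       map_add' := fun _ _ => rfl
       map_smul' := fun _ _ => rfl } : (Fin 3 → polySpace r) →ₗ[ℝ] E3 → E3)

theorem mem_polyVecSpace {r : ℕ} {v : E3 → E3} : v ∈ polyVecSpace r ↔ IsPolyVec r v := by
  constructor
  · rintro ⟨p, rfl⟩ i
    exact mem_polySpace.1 (p i).2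
  · intro h
    exact ⟨fun i => ⟨fun x => v x i, mem_polySpace.2 (h i)⟩, rfl⟩

instance (r : ℕ) : FiniteDimensional ℝ (polyVecSpace r) := by
  unfold polyVecSpace; infer_instance

theorem IsPoly.continuous {r : ℕ} {f : E3 → ℝ} (hf : IsPoly r f) : Continuous f := by
  obtain ⟨p, -, hp⟩ := hf
  rw [funext hp]
  exact p.continuous_eval.comp (by fun_prop)

theorem IsPolyVec.continuous {r : ℕ} {v : E3 → E3} (hv : IsPolyVec r v) : Continuous v :=
  (PiLp.continuous_toLp 2 fun _ : Fin 3 => ℝ).comp (continuous_pi fun i => (hv i).continuous)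

theorem IsPoly.mono {r r' : ℕ} (h : r ≤ r') {f : E3 → ℝ} (hf : IsPoly r f) : IsPoly r' f := by
  obtain ⟨p, hp, he⟩ := hf
  exact ⟨p, hp.trans h, he⟩

theorem IsPoly.add {r : ℕ} {f g : E3 → ℝ} (hf : IsPoly r f) (hg : IsPoly r g) :
    IsPoly r (fun x => f x + g x) :=
  mem_polySpace.1 ((polySpace r).add_mem (mem_polySpace.2 hf) (mem_polySpace.2 hg))

theorem isPoly_one (r : ℕ) : IsPoly r (fun _ => 1) :=
  ⟨1, by simp, by simp⟩

theorem IsPoly.mul_coord {r : ℕ} {f : E3 → ℝ} (hf : IsPoly r f) (i : Fin 3) :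
    IsPoly (r + 1) (fun x => f x * x i) := by
  obtain ⟨p, hp, he⟩ := hf
  refine ⟨p * MvPolynomial.X i, ?_, fun x => by simp [he x]⟩
  refine (MvPolynomial.totalDegree_mul _ _).trans ?_
  rw [MvPolynomial.totalDegree_X]
  lia

variable {M : TetMesh}

/-- Members of the Raviart–Thomas space `RT_r` are piecewise of degree at most `r + 1`. -/
theorem isPolyVec_of_mem_RT {r : ℕ} {B : M.Field E3} (hB : B ∈ RT M r) (K : M.Tet) :
    IsPolyVec (r + 1) (B K) := by
  obtain ⟨a, q, ha, hq, h⟩ := hB.1 K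
  intro i
  have : (fun x => B K x i) = fun x => a x i + q x * x i := by
    ext x; simp [h x]
  rw [this]
  exact ((ha i).mono (Nat.le_succ r)).add (hq.mul_coord i)

/-! ### Algebra of the discrete forms -/

theorem isCompact_cell (K : M.Tet) : IsCompact (cell K) :=
  K.1.finite_toSet.isCompact_convexHull (𝕜 := ℝ)

theorem cell_subset_closedDomain (K : M.Tet) : cell K ⊆ M.closedDomain :=
  M.complex.convexHull_subset_space K.2.1

theorem ip_comm {V : Type} [NormedAddCommGroup V] [InnerProductSpace ℝ V] (f g : M.Field V) :
    ip f g = ip g f := by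
  simp only [ip, real_inner_comm]

theorem cellInt_const_mul (c : ℝ) (f : M.Field ℝ) :
    cellInt (fun K x => c * f K x) = c * cellInt f := by
  simp only [cellInt, integral_const_mul, Finset.mul_sum]

theorem facetInt_const_mul (c : ℝ) (e : Finset E3) (f : E3 → ℝ) :
    facetInt e (fun x => c * f x) = c * facetInt e f := by
  simp only [facetInt, integral_const_mul]

theorem bdryInt_const_mul (c : ℝ) (F : M.Tet → E3 → E3 → ℝ) :
    M.bdryInt (fun K n x => c * F K n x) = c * M.bdryInt F := by
  simp only [bdryInt, facetInt_const_mul, Finset.mul_sum]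

theorem aForm_self (w u : M.Field E3) : aForm w u u = 0 := by
  simp [aForm, cellInt]

theorem avg_const_smul (c : ℝ) (D : M.Field E3) (e : Finset E3) (x : E3) :
    avg (c • D) e x = c • avg D e x := by
  simp only [avg, Pi.smul_apply, ← Finset.smul_sum]
  rw [smul_comm]

/-- The Seebeck–Peltier form is homogeneous in its magnetic argument. -/
theorem hForm_const_smul (α w g : M.Field ℝ) (c : ℝ) (D : M.Field E3) :
    hForm α w g (c • D) = c * hForm α w g D := by
  simp only [hForm, avg_const_smul, Pi.smul_apply, real_inner_smul_left, bdryInt_const_mul,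
    cellInt_const_mul, facetInt_const_mul, ← Finset.mul_sum]
  ring

theorem inner_E3 (a b : E3) : inner ℝ a b = a 0 * b 0 + a 1 * b 1 + a 2 * b 2 := by
  simp only [PiLp.inner_apply, Fin.sum_univ_three, RCLike.inner_apply, conj_trivial]
  ring

/-- The triple product changes sign when its outer factors are exchanged. -/
theorem inner_cross_swap (a b c : E3) : inner ℝ (cross a b) c = - inner ℝ (cross c b) a := by
  simp only [inner_E3, cross]
  simp
  ring

theorem ip_bcross_swap (a b c : M.Field E3) : ip (bcross a b) c = - ip (bcross c b) a := by
  simp only [ip, cellInt, bcross, ← Finset.sum_neg_distrib, ← integral_neg]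
  simp only [← inner_cross_swap]

theorem isProj_self {V : Type} [NormedAddCommGroup V] [InnerProductSpace ℝ V]
    {S : Set (M.Field V)} {f : M.Field V} (hf : f ∈ S) : IsProj S f f :=
  ⟨hf, fun _ _ => rfl⟩

theorem Variant.represents_self (var : Variant) {V : Type} [NormedAddCommGroup V]
    [InnerProductSpace ℝ V] {S : Set (M.Field V)} {f : M.Field V} (hf : f ∈ S) :
    var.Represents S f f := by
  cases var
  · exact isProj_self hf
  · rfl

/-! ### Power balance of the scheme -/

/-- The right-hand side is the time derivative of the total energy by the chain rule. Testing the
momentum, induction, mass and entropy equations with `u`, `B`, `θ` and `1` makes advection,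
viscous heating, heat conduction and the thermoelectric terms cancel; the definition of `J` cancels the Ohmic
heating, and those of `E`, `L`, `U` reduce the remaining work to a triple product that is
skew-symmetric. -/
theorem IsSolution.power_balance {P : PhysData M} {bc : ThermalBC M} {var : Variant} {r k : ℕ}
    {I : Set ℝ} {α : ℝ → M.Field ℝ} {X : Unknowns M} (hX : IsSolution P bc var r k I α X)
    {t : ℝ} (ht : t ∈ I) :
    ip (dt I (fun τ => P.dl_du (X.u τ) (X.ρ τ)) t) (X.u t) - ip (X.θ t) (dt I X.ρ t)
      + ip (X.T t) (dt I X.s t) + P.μ₀⁻¹ * ip (X.B t) (dt I X.B t)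
    = - eForm P bc 1 (X.T t) := by
  obtain ⟨m, -, hmom⟩ := hX.momentum t ht
  have hmom := hmom (X.u t) (hX.u_mem t ht)
  rw [aForm_self] at hmom
  have hind := hX.induction t ht (X.B t) (hX.B_mem t ht)
  have hθ := (hX.θ_eq t ht).1
  have hT := (hX.T_eq t ht).1
  have hmass := hX.mass t ht (X.θ t) hθ
  have hone : (1 : M.Field ℝ) ∈ DG M k := fun K => isPoly_one k
  have hent := hX.entropy t ht 1 hone (X.T t)
    (by rw [mul_one]; exact var.represents_self hT)
  have hdB : - P.dl_dB (X.B t) = P.μ₀⁻¹ • X.B t := by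
    ext K x : 2; simp [PhysData.dl_dB]
  rw [mul_one, hdB, hForm_const_smul] at hent
  have hJJ := hX.J_eq t ht (X.J t) (hX.J_mem t ht)
  have hJE := hX.J_eq t ht (X.E t) (hX.E_mem t ht)
  have hEJ := hX.E_eq t ht (X.J t) (hX.J_mem t ht)
  have hUL := hX.U_eq t ht (X.L t) (hX.L_mem t ht)
  have hLU := hX.L_eq t ht (X.U t) (hX.U_mem t ht)
  have hsw := ip_bcross_swap (X.U t) (X.H t) (X.J t)
  have hnorm : cellInt (fun K x => (1 : M.Field ℝ) K x * ‖X.J t K x‖ ^ 2)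
      = ip (X.J t) (X.J t) := by
    simp [ip]
  rw [hnorm] at hent
  rw [one_div] at hJJ hJE
  rw [ip_comm (X.θ t), ip_comm (X.T t), ip_comm (X.B t)]
  rw [ip_comm (X.B t)] at hJJ hJE
  rw [ip_comm (X.J t) (X.E t)] at hJE
  rw [ip_comm (X.U t), ip_comm (X.u t)] at hUL
  linear_combination hmom - hmass + hent + P.μ₀⁻¹ * hind + P.ν * hJJ + hJE - hEJ + hUL - hLU + hsw

/-! ### Equation of state -/

namespace PhysData

/-- The differential of `ε` at an admissible state, in terms of the partial derivatives. -/
theorem hasFDerivAt_ε (P : PhysData M) {p : ℝ × ℝ} (hp : p ∈ P.states) :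
    HasFDerivAt (fun q : ℝ × ℝ => P.ε q.1 q.2)
      (fderiv ℝ (fun q : ℝ × ℝ => P.ε q.1 q.2) p) p :=
  ((P.ε_contDiff.contDiffAt (P.states_open.mem_nhds hp)).differentiableAt one_ne_zero).hasFDerivAt

theorem deriv_ε_fst (P : PhysData M) {p : ℝ × ℝ} (hp : p ∈ P.states) :
    deriv (fun a => P.ε a p.2) p.1 = fderiv ℝ (fun q : ℝ × ℝ => P.ε q.1 q.2) p (1, 0) :=
  ((P.hasFDerivAt_ε hp).comp_hasDerivAt (f := fun a => (a, p.2)) p.1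
    ((hasDerivAt_id p.1).prodMk (hasDerivAt_const p.1 p.2))).deriv

theorem deriv_ε_snd (P : PhysData M) {p : ℝ × ℝ} (hp : p ∈ P.states) :
    deriv (fun a => P.ε p.1 a) p.2 = fderiv ℝ (fun q : ℝ × ℝ => P.ε q.1 q.2) p (0, 1) :=
  ((P.hasFDerivAt_ε hp).comp_hasDerivAt (f := fun a => (p.1, a)) p.2
    ((hasDerivAt_const p.2 p.1).prodMk (hasDerivAt_id p.2))).deriv

theorem continuousOn_fderiv_ε (P : PhysData M) (v : ℝ × ℝ) :
    ContinuousOn (fun p => fderiv ℝ (fun q : ℝ × ℝ => P.ε q.1 q.2) p v) P.states :=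
  (P.ε_contDiff.continuousOn_fderiv_of_isOpen P.states_open le_rfl).clm_apply continuousOn_const

theorem hasDerivWithinAt_ε (P : PhysData M) {ρ s : ℝ → ℝ} {ρ' s' t : ℝ} {I : Set ℝ}
    (h : (ρ t, s t) ∈ P.states) (hρ : HasDerivWithinAt ρ ρ' I t)
    (hs : HasDerivWithinAt s s' I t) :
    HasDerivWithinAt (fun τ => P.ε (ρ τ) (s τ))
      (deriv (fun a => P.ε a (s t)) (ρ t) * ρ' + deriv (fun a => P.ε (ρ t) a) (s t) * s') I t := by
  have := (P.hasFDerivAt_ε h).comp_hasDerivWithinAt t (hρ.prodMk hs)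
  refine this.congr_deriv ?_
  rw [P.deriv_ε_fst h, P.deriv_ε_snd h]
  have : ((ρ', s') : ℝ × ℝ) = ρ' • (1, 0) + s' • (0, 1) := by simp
  rw [this, map_add, map_smul, map_smul, smul_eq_mul, smul_eq_mul]
  ring

end PhysData

/-! ### Time derivative of the total energy -/

/-- The total energy density at one point, as a function of `((ρ, s), (u, B), φ)`. -/
def energyDensity (P : PhysData M) (z : (ℝ × ℝ) × (E3 × E3) × ℝ) : ℝ :=
  1 / 2 * z.1.1 * ‖z.2.1.1‖ ^ 2 + P.ε z.1.1 z.1.2 + 1 / (2 * P.μ₀) * ‖z.2.1.2‖ ^ 2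
    + z.1.1 * z.2.2

theorem contDiffOn_energyDensity (P : PhysData M) :
    ContDiffOn ℝ 1 (energyDensity P) (P.states ×ˢ Set.univ) := by
  have hε : ContDiffOn ℝ 1 (fun z : (ℝ × ℝ) × (E3 × E3) × ℝ => P.ε z.1.1 z.1.2)
      (P.states ×ˢ Set.univ) :=
    P.ε_contDiff.comp contDiff_fst.contDiffOn fun z hz => hz.1
  have hρ : ContDiff ℝ 1 (fun z : (ℝ × ℝ) × (E3 × E3) × ℝ => z.1.1) := by fun_prop
  have hφ : ContDiff ℝ 1 (fun z : (ℝ × ℝ) × (E3 × E3) × ℝ => z.2.2) := by fun_prop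
  have hu : ContDiff ℝ 1 (fun z : (ℝ × ℝ) × (E3 × E3) × ℝ => ‖z.2.1.1‖ ^ 2) :=
    ContDiff.norm_sq ℝ (by fun_prop)
  have hB : ContDiff ℝ 1 (fun z : (ℝ × ℝ) × (E3 × E3) × ℝ => ‖z.2.1.2‖ ^ 2) :=
    ContDiff.norm_sq ℝ (by fun_prop)
  exact ((((contDiff_const.mul hρ).mul hu).contDiffOn.add hε).add
    (contDiff_const.mul hB).contDiffOn).add (hρ.mul hφ).contDiffOn

/-- The arguments of the energy density along a solution. -/
def Unknowns.state (X : Unknowns M) (P : PhysData M) (K : M.Tet) (t : ℝ) (x : E3) :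
    (ℝ × ℝ) × (E3 × E3) × ℝ :=
  ((X.ρ t K x, X.s t K x), (X.u t K x, X.B t K x), P.φ x)

namespace IsSolution

variable {P : PhysData M} {bc : ThermalBC M} {var : Variant} {r k : ℕ} {I : Set ℝ}
  {α : ℝ → M.Field ℝ} {X : Unknowns M}

theorem continuousOn_state (hX : IsSolution P bc var r k I α X) {t : ℝ} (ht : t ∈ I)
    (K : M.Tet) : ContinuousOn (X.state P K t) (cell K) :=
  (((hX.ρ_mem t ht K).continuous.prodMk (hX.s_mem t ht K).continuous).continuousOn).prodMk
    ((((hX.u_mem t ht).1 K).continuous.prodMk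
      (isPolyVec_of_mem_RT (hX.B_mem t ht) K).continuous).continuousOn.prodMk
      (P.φ_cont.mono (cell_subset_closedDomain K)))

theorem mapsTo_state (hX : IsSolution P bc var r k I α X) {t : ℝ} (ht : t ∈ I)
    (K : M.Tet) : Set.MapsTo (X.state P K t) (cell K) (P.states ×ˢ Set.univ) :=
  fun x hx => ⟨hX.states_mem t ht K x hx, trivial⟩

theorem continuousOn_dl_du (hX : IsSolution P bc var r k I α X) {t : ℝ} (ht : t ∈ I)
    (K : M.Tet) : ContinuousOn (P.dl_du (X.u t) (X.ρ t) K) (cell K) :=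
  (hX.ρ_mem t ht K).continuous.continuousOn.smul (((hX.u_mem t ht).1 K).continuous.continuousOn.add
    (P.R_cont.mono (cell_subset_closedDomain K)))

theorem continuousOn_dl_ds (hX : IsSolution P bc var r k I α X) {t : ℝ} (ht : t ∈ I)
    (K : M.Tet) : ContinuousOn (P.dl_ds (X.ρ t) (X.s t) K) (cell K) := by
  have h := (P.continuousOn_fderiv_ε (0, 1)).comp
    ((hX.ρ_mem t ht K).continuous.prodMk (hX.s_mem t ht K).continuous).continuousOn
    (hX.states_mem t ht K)
  exact (h.congr fun x hx => P.deriv_ε_snd (hX.states_mem t ht K x hx)).neg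

theorem continuousOn_dl_drho (hX : IsSolution P bc var r k I α X) {t : ℝ} (ht : t ∈ I)
    (K : M.Tet) : ContinuousOn (P.dl_drho (X.u t) (X.ρ t) (X.s t) K) (cell K) := by
  have h := (P.continuousOn_fderiv_ε (1, 0)).comp
    ((hX.ρ_mem t ht K).continuous.prodMk (hX.s_mem t ht K).continuous).continuousOn
    (hX.states_mem t ht K)
  have h' := h.congr fun x hx => P.deriv_ε_fst (hX.states_mem t ht K x hx)
  have hu := ((hX.u_mem t ht).1 K).continuous.continuousOn (s := cell K)
  exact (((continuousOn_const.mul (hu.norm.pow 2)).add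
    ((P.R_cont.mono (cell_subset_closedDomain K)).inner hu)).sub h').sub
    (P.φ_cont.mono (cell_subset_closedDomain K))

theorem energy_eq (hX : IsSolution P bc var r k I α X) {t : ℝ} (ht : t ∈ I) :
    X.energy P t = ∑ K : M.Tet, ∫ x in cell K, energyDensity P (X.state P K t x) := by
  have hR := fun K : M.Tet => P.R_cont.mono (cell_subset_closedDomain K)
  have hu := fun K : M.Tet => ((hX.u_mem t ht).1 K).continuous.continuousOn (s := cell K)
  rw [Unknowns.energy, PhysData.energy, PhysData.lagrangian, ip, cellInt, cellInt,
    ← Finset.sum_sub_distrib]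
  refine Finset.sum_congr rfl fun K _ => ?_
  have h1 : IntegrableOn (fun x => inner ℝ (P.dl_du (X.u t) (X.ρ t) K x) (X.u t K x)) (cell K) :=
    ((hX.continuousOn_dl_du ht K).inner (hu K)).integrableOn_compact (isCompact_cell K)
  have h2 : IntegrableOn (fun x => energyDensity P (X.state P K t x)) (cell K) :=
    ((contDiffOn_energyDensity P).continuousOn.comp (hX.continuousOn_state ht K)
      (hX.mapsTo_state ht K)).integrableOn_compact (isCompact_cell K)
  have h3 : ∀ x, 1 / 2 * X.ρ t K x * ‖X.u t K x‖ ^ 2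
      + X.ρ t K x * inner ℝ (P.R x) (X.u t K x) - P.ε (X.ρ t K x) (X.s t K x)
      - 1 / (2 * P.μ₀) * ‖X.B t K x‖ ^ 2 - X.ρ t K x * P.φ x
      = inner ℝ (P.dl_du (X.u t) (X.ρ t) K x) (X.u t K x)
        - energyDensity P (X.state P K t x) := by
    intro x
    simp only [PhysData.dl_du, energyDensity, Unknowns.state, real_inner_smul_left,
      inner_add_left, real_inner_self_eq_norm_sq]
    ring
  simp only [h3]
  rw [integral_sub h1 h2, sub_sub_cancel]

theorem dt_ρ_mem (hX : IsSolution P bc var r k I α X) {t : ℝ} (ht : t ∈ I)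
    (hI : UniqueDiffWithinAt ℝ I t) : dt I X.ρ t ∈ DG M k := fun K =>
  mem_polySpace.1 <| hasDerivWithinAt_mem_finiteDimensional (polySpace k)
    (f := fun τ => X.ρ τ K) ht hI (fun τ hτ => mem_polySpace.2 (hX.ρ_mem τ hτ K))
    fun x => (hX.ρ_diff K x t ht).hasDerivWithinAt

theorem dt_s_mem (hX : IsSolution P bc var r k I α X) {t : ℝ} (ht : t ∈ I)
    (hI : UniqueDiffWithinAt ℝ I t) : dt I X.s t ∈ DG M k := fun K =>
  mem_polySpace.1 <| hasDerivWithinAt_mem_finiteDimensional (polySpace k)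
    (f := fun τ => X.s τ K) ht hI (fun τ hτ => mem_polySpace.2 (hX.s_mem τ hτ K))
    fun x => (hX.s_diff K x t ht).hasDerivWithinAt

theorem isPolyVec_dt_u (hX : IsSolution P bc var r k I α X) {t : ℝ} (ht : t ∈ I)
    (hI : UniqueDiffWithinAt ℝ I t) (K : M.Tet) : IsPolyVec (r + 1) (dt I X.u t K) :=
  mem_polyVecSpace.1 <| hasDerivWithinAt_mem_finiteDimensional (polyVecSpace (r + 1))
    (f := fun τ => X.u τ K) ht hI (fun τ hτ => mem_polyVecSpace.2 ((hX.u_mem τ hτ).1 K))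
    fun x => (hX.u_diff K x t ht).hasDerivWithinAt

theorem isPolyVec_dt_B (hX : IsSolution P bc var r k I α X) {t : ℝ} (ht : t ∈ I)
    (hI : UniqueDiffWithinAt ℝ I t) (K : M.Tet) : IsPolyVec (r + 1) (dt I X.B t K) :=
  mem_polyVecSpace.1 <| hasDerivWithinAt_mem_finiteDimensional (polyVecSpace (r + 1))
    (f := fun τ => X.B τ K) ht hI
    (fun τ hτ => mem_polyVecSpace.2 (isPolyVec_of_mem_RT (hX.B_mem τ hτ) K))
    fun x => (hX.B_diff K x t ht).hasDerivWithinAt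

theorem hasBoundedSlopesOn_state (hX : IsSolution P bc var r k I α X) {t : ℝ} (ht : t ∈ I)
    (hI : UniqueDiffWithinAt ℝ I t) (K : M.Tet) :
    HasBoundedSlopesOn (X.state P K) (cell K) I t := by
  have hc := isCompact_cell K
  have hp : ∀ w ∈ polySpace k, Continuous w := fun w hw => (mem_polySpace.1 hw).continuous
  have hv : ∀ w ∈ polyVecSpace (r + 1), Continuous w :=
    fun w hw => (mem_polyVecSpace.1 hw).continuous
  have hρ := hasBoundedSlopesOn_of_finiteDimensional (polySpace k) hp hc
    (f := fun τ => X.ρ τ K) ht hI (fun τ hτ => mem_polySpace.2 (hX.ρ_mem τ hτ K))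
    fun x => (hX.ρ_diff K x t ht).hasDerivWithinAt
  have hs := hasBoundedSlopesOn_of_finiteDimensional (polySpace k) hp hc
    (f := fun τ => X.s τ K) ht hI (fun τ hτ => mem_polySpace.2 (hX.s_mem τ hτ K))
    fun x => (hX.s_diff K x t ht).hasDerivWithinAt
  have hu := hasBoundedSlopesOn_of_finiteDimensional (polyVecSpace (r + 1)) hv hc
    (f := fun τ => X.u τ K) ht hI (fun τ hτ => mem_polyVecSpace.2 ((hX.u_mem τ hτ).1 K))
    fun x => (hX.u_diff K x t ht).hasDerivWithinAt
  have hB := hasBoundedSlopesOn_of_finiteDimensional (polyVecSpace (r + 1)) hv hc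
    (f := fun τ => X.B τ K) ht hI
    (fun τ hτ => mem_polyVecSpace.2 (isPolyVec_of_mem_RT (hX.B_mem τ hτ) K))
    fun x => (hX.B_diff K x t ht).hasDerivWithinAt
  exact (hρ.prodMk hs).prodMk ((hu.prodMk hB).prodMk (hasBoundedSlopesOn_const P.φ _ _ _))

theorem dt_dl_du (hX : IsSolution P bc var r k I α X) {t : ℝ} (ht : t ∈ I)
    (hI : UniqueDiffWithinAt ℝ I t) (K : M.Tet) (x : E3) :
    dt I (fun τ => P.dl_du (X.u τ) (X.ρ τ)) t K x
      = X.ρ t K x • dt I X.u t K x + dt I X.ρ t K x • (X.u t K x + P.R x) :=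
  ((hX.ρ_diff K x t ht).hasDerivWithinAt.smul
    ((hX.u_diff K x t ht).hasDerivWithinAt.add_const (P.R x))).derivWithin hI

/-- The chain rule for the energy density, with the derivative written in terms of the functional
derivatives of the Lagrangian. -/
theorem hasDerivWithinAt_energyDensity (hX : IsSolution P bc var r k I α X) {t : ℝ} (ht : t ∈ I)
    (hI : UniqueDiffWithinAt ℝ I t) (K : M.Tet) {x : E3} (hx : x ∈ cell K) :
    HasDerivWithinAt (fun τ => energyDensity P (X.state P K τ x))
      (inner ℝ (dt I (fun τ => P.dl_du (X.u τ) (X.ρ τ)) t K x) (X.u t K x)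
        - inner ℝ (P.dl_drho (X.u t) (X.ρ t) (X.s t) K x) (dt I X.ρ t K x)
        + inner ℝ ((- P.dl_ds (X.ρ t) (X.s t)) K x) (dt I X.s t K x)
        + P.μ₀⁻¹ * inner ℝ (X.B t K x) (dt I X.B t K x)) I t := by
  have hρ : HasDerivWithinAt (fun τ => X.ρ τ K x) (dt I X.ρ t K x) I t :=
    (hX.ρ_diff K x t ht).hasDerivWithinAt
  have hs : HasDerivWithinAt (fun τ => X.s τ K x) (dt I X.s t K x) I t :=
    (hX.s_diff K x t ht).hasDerivWithinAt
  have hu : HasDerivWithinAt (fun τ => X.u τ K x) (dt I X.u t K x) I t :=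
    (hX.u_diff K x t ht).hasDerivWithinAt
  have hB : HasDerivWithinAt (fun τ => X.B τ K x) (dt I X.B t K x) I t :=
    (hX.B_diff K x t ht).hasDerivWithinAt
  have h := ((((hρ.const_mul (1 / 2)).mul hu.norm_sq).add
    (P.hasDerivWithinAt_ε (hX.states_mem t ht K x hx) hρ hs)).add
    (hB.norm_sq.const_mul (1 / (2 * P.μ₀)))).add (hρ.mul_const (P.φ x))
  refine h.congr_deriv ?_
  have hμ := P.μ₀_pos.ne'
  rw [hX.dt_dl_du ht hI]
  simp only [PhysData.dl_drho, PhysData.dl_ds, inner_add_left, real_inner_smul_left,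
    real_inner_self_eq_norm_sq, Pi.neg_apply, neg_neg, RCLike.inner_apply, conj_trivial,
    real_inner_comm (X.u t K x) (dt I X.u t K x)]
  field_simp
  ring

/-- The time derivative of the total energy by the chain rule: differentiation under the integral
sign on each tetrahedron. -/
theorem hasDerivWithinAt_energy_chain (hX : IsSolution P bc var r k I α X) {t : ℝ} (ht : t ∈ I)
    (hI : UniqueDiffWithinAt ℝ I t) :
    HasDerivWithinAt (X.energy P)
      (ip (dt I (fun τ => P.dl_du (X.u τ) (X.ρ τ)) t) (X.u t)
        - ip (P.dl_drho (X.u t) (X.ρ t) (X.s t)) (dt I X.ρ t)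
        + ip (- P.dl_ds (X.ρ t) (X.s t)) (dt I X.s t)
        + P.μ₀⁻¹ * ip (X.B t) (dt I X.B t)) I t := by
  have h := HasDerivWithinAt.fun_sum (u := Finset.univ) fun (K : M.Tet) _ =>
    hasDerivWithinAt_setIntegral_comp (m := volume) (P.states_open.prod isOpen_univ)
      (contDiffOn_energyDensity P) (isCompact_cell K) ht
      (fun τ hτ => hX.continuousOn_state hτ K) (fun τ hτ => hX.mapsTo_state hτ K)
      (hX.hasBoundedSlopesOn_state ht hI K)
      (fun x hx => hX.hasDerivWithinAt_energyDensity ht hI K hx)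
  refine (h.congr (fun τ hτ => hX.energy_eq hτ) (hX.energy_eq ht)).congr_deriv ?_
  simp only [ip, cellInt]
  rw [Finset.mul_sum, ← Finset.sum_sub_distrib, ← Finset.sum_add_distrib, ← Finset.sum_add_distrib]
  refine Finset.sum_congr rfl fun K _ => ?_
  have hc := isCompact_cell K
  have hu := ((hX.u_mem t ht).1 K).continuous.continuousOn (s := cell K)
  have hρ' := (hX.dt_ρ_mem ht hI K).continuous.continuousOn (s := cell K)
  have hw : ContinuousOn (dt I (fun τ => P.dl_du (X.u τ) (X.ρ τ)) t K) (cell K) := by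
    rw [funext (hX.dt_dl_du ht hI K)]
    exact ((hX.ρ_mem t ht K).continuous.continuousOn.smul
      (hX.isPolyVec_dt_u ht hI K).continuous.continuousOn).add
      (hρ'.smul (hu.add (P.R_cont.mono (cell_subset_closedDomain K))))
  have h1 := (hw.inner (𝕜 := ℝ) hu).integrableOn_compact (μ := volume) hc
  have h2 := ((hX.continuousOn_dl_drho ht K).inner (𝕜 := ℝ) hρ').integrableOn_compact
    (μ := volume) hc
  have h3 := ((hX.continuousOn_dl_ds ht K).neg.inner (𝕜 := ℝ)
    (hX.dt_s_mem ht hI K).continuous.continuousOn).integrableOn_compact (μ := volume) hc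
  have h4 := (((isPolyVec_of_mem_RT (hX.B_mem t ht) K).continuous.inner (𝕜 := ℝ)
    (hX.isPolyVec_dt_B ht hI K).continuous).continuousOn.integrableOn_compact
    (μ := volume) hc).const_mul P.μ₀⁻¹
  rw [← integral_const_mul]
  exact (integral_add ((h1.sub h2).add h3) h4).trans (congrArg (· + _)
    ((integral_add (h1.sub h2) h3).trans (congrArg (· + _) (integral_sub h1 h2))))

theorem hasDerivWithinAt_energy (hX : IsSolution P bc var r k I α X) {t : ℝ} (ht : t ∈ I)
    (hI : UniqueDiffWithinAt ℝ I t) :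
    HasDerivWithinAt (X.energy P) (- eForm P bc 1 (X.T t)) I t := by
  refine (hX.hasDerivWithinAt_energy_chain ht hI).congr_deriv ?_
  -- `∂ₜρ` and `∂ₜs` are admissible test functions, so that `δℓ/δρ` and `-δℓ/δs` may be replaced by
  -- their projections `θ` and `T`
  rw [← hX.power_balance ht, (hX.θ_eq t ht).2 _ (hX.dt_ρ_mem ht hI),
    (hX.T_eq t ht).2 _ (hX.dt_s_mem ht hI)]

end IsSolution

/-! ### Thermal boundary conditions -/

/-- For the Dirichlet condition, `eₕ(1, T)` is the boundary flux of `T₀ j_s` plus the penalty. -/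
theorem eForm_dirichlet_one (P : PhysData M) (T₀ : E3 → ℝ) (hT : M.BdryIntegrable T₀)
    (T : M.Field ℝ) :
    eForm P (.dirichlet T₀ hT) 1 T
      = M.bdryInt (fun K n x => T₀ x * inner ℝ (entropyFlux P T K x) n)
        + bdryPenalty P T₀ 1 T := by
  simp only [eForm]
  rw [neg_eq_neg_one_mul, ← bdryInt_const_mul]
  congr 2
  ext K n x
  simp only [entropyFlux, inner_neg_left, real_inner_smul_left, Pi.one_apply]
  ring

theorem bdryPenalty_eq_zero (P : PhysData M) {T₀ : E3 → ℝ} (w : M.Field ℝ) {T : M.Field ℝ}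
    (h : ∀ e ∈ M.bdryFacets, ∀ K ∈ M.adj e, ∀ x ∈ convexHull ℝ (e : Set E3), T K x = T₀ x) :
    bdryPenalty P T₀ w T = 0 := by
  refine Finset.sum_eq_zero fun e he => mul_eq_zero_of_right _ (Finset.sum_eq_zero fun K hK => ?_)
  refine setIntegral_eq_zero_of_forall_eq_zero fun x hx => ?_
  rw [h e he K hK x hx, sub_self, mul_zero]

end MHD

end

theorem mainTheorem1 (M : MHD.TetMesh) (P : MHD.PhysData M) (bc : MHD.ThermalBC M)
    (var : MHD.Variant) (r k : ℕ) (I : Set ℝ) (hI : I.OrdConnected) (hI' : I.Nontrivial)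
    (α : ℝ → M.Field ℝ) (X : MHD.Unknowns M)
    (hX : MHD.IsSolution P bc var r k I α X) :
    -- energy balance
    (∀ t ∈ I, HasDerivWithinAt (X.energy P) (- MHD.eForm P bc 1 (X.T t)) I t) ∧
    -- homogeneous Neumann conditions: the total energy is conserved
    (bc = MHD.ThermalBC.homNeumann → ∀ t₁ ∈ I, ∀ t₂ ∈ I, X.energy P t₁ = X.energy P t₂) ∧
    -- nonhomogeneous Neumann conditions: the energy changes by the prescribed heat flux
    (∀ q₀ hq, bc = MHD.ThermalBC.neumann q₀ hq → ∀ t ∈ I,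
      HasDerivWithinAt (X.energy P) (- M.bdryInt (fun _ _ x => q₀ x)) I t) ∧
    -- Dirichlet conditions: the energy changes by the boundary heat flux, which includes the
    -- penalty term that imposes the boundary condition
    (∀ T₀ hT, bc = MHD.ThermalBC.dirichlet T₀ hT → ∀ t ∈ I,
      HasDerivWithinAt (X.energy P)
        (- (M.bdryInt (fun K n x => T₀ x * inner ℝ (MHD.entropyFlux P (X.T t) K x) n)
          + MHD.bdryPenalty P T₀ 1 (X.T t))) I t ∧
      ((∀ e ∈ M.bdryFacets, ∀ K ∈ M.adj e, ∀ x ∈ convexHull ℝ (e : Set MHD.E3),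
          X.T t K x = T₀ x) →
        HasDerivWithinAt (X.energy P)
          (- M.bdryInt (fun K n x => T₀ x * inner ℝ (MHD.entropyFlux P (X.T t) K x) n)) I t)) := by
  have hU : ∀ t ∈ I, UniqueDiffWithinAt ℝ I t := fun t ht =>
    uniqueDiffWithinAt_iff_accPt.2 (hI.isPreconnected.preperfect_of_nontrivial hI' t ht)
  have hE : ∀ t ∈ I, HasDerivWithinAt (X.energy P) (- MHD.eForm P bc 1 (X.T t)) I t :=
    fun t ht => hX.hasDerivWithinAt_energy ht (hU t ht)
  refine ⟨hE, ?_, ?_, ?_⟩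
  · rintro rfl t₁ h₁ t₂ h₂
    have h0 : ∀ t ∈ I, HasDerivWithinAt (X.energy P) 0 I t := fun t ht =>
      (hE t ht).congr_deriv (by simp [MHD.eForm])
    refine hI.convex.is_const_of_fderivWithin_eq_zero (𝕜 := ℝ)
      (fun t ht => (h0 t ht).differentiableWithinAt) (fun t ht => ?_) h₁ h₂
    have := (h0 t ht).hasFDerivWithinAt.fderivWithin (hU t ht)
    simpa using this
  · rintro q₀ hq rfl t ht
    exact (hE t ht).congr_deriv (by simp [MHD.eForm])
  · rintro T₀ hT rfl t ht
    have h := hE t ht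
    rw [MHD.eForm_dirichlet_one] at h
    refine ⟨h, fun hbd => ?_⟩
    rwa [MHD.bdryPenalty_eq_zero P 1 hbd, add_zero] at h
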